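/- Let $n\ge 1$, let $X$ be uniformly distributed on $\{0,1\}^n$, and for $x\in\{0,1\}^n$ let $x^{(i)}$ denote $x$ with its $i$-th bit flipped. Let $v>0$ and let $f:\{0,1\}^n\to\mathbb{R}$ satisfy $$\sum_{i=1}^n \big(f(x)-f(x^{(i)})\big)_+^2\le v\qquad\text{for all }x\in\{0,1\}^n,$$ where $u_+=\max(u,0)$. Put $B=\max_{x,i}|f(x)-f(x^{(i)})|$ and let $\mathbf{M}f=\inf\{z:\mathbf{P}\{f(X)\le z\}\ge 1/2\}$ be the median of $f(X)$. Then for all real $b>a\ge \mathbf{M}f$ with $\mathbf{P}\{f(X)\ge b\}>0$, $$b-a\le\sqrt{\frac{(72/5)\,v\,\mathbf{P}\{f(X)\in(a,b+B)\}}{\mathbf{P}\{f(X)\ge b\}\,\log\!\big(e^2/(2\mathbf{P}\{f(X)\in(a,b+B)\})\big)}}\le\sqrt{\frac{(72/5)\,v\,\mathbf{P}\{f(X)>a\}}{\mathbf{P}\{f(X)\ge b\}\,\log\!\big(e^2/(2\mathbf{P}\{f(X)>a\})\big)}}.$$ -/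

import Mathlib

open MeasureTheory

noncomputable section

namespace LocalTail

/-- The binary hypercube `{0,1}^n`. -/
abbrev Cube (n : ℕ) : Type := Fin n → Bool

/-- The point `x^(i)`, obtained from `x` by flipping the `i`-th bit. -/
def flipBit {n : ℕ} (x : Cube n) (i : Fin n) : Cube n :=
  Function.update x i (!(x i))

/-- The uniform distribution on the cube, i.e. the law of `X`. -/
def unif (n : ℕ) : Measure (Cube n) :=
  ProbabilityTheory.uniformOn (Set.univ : Set (Cube n))

/-- `P{f(X) ∈ S}` for `X` uniform on the cube. -/
def prob {n : ℕ} (f : Cube n → ℝ) (S : Set ℝ) : ℝ :=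
  (unif n).real {x | f x ∈ S}

/-- The `α`-quantile `Q_α = inf {z : P{f(X) ≤ z} ≥ α}`, for `α ∈ (0,1)`. -/
def quantile {n : ℕ} (f : Cube n → ℝ) (α : ℝ) : ℝ :=
  sInf {z : ℝ | α ≤ prob f (Set.Iic z)}

/-- The median `M f = Q_{1/2}`. -/
def median {n : ℕ} (f : Cube n → ℝ) : ℝ :=
  quantile f (1 / 2)

/-- `B = max_{x,i} |f(x) - f(x^(i))|`; the index set is finite, so for `n ≥ 1` the supremum is
a maximum (and for `n = 0` it is `0`). -/
def maxChange {n : ℕ} (f : Cube n → ℝ) : ℝ :=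
  ⨆ p : Cube n × Fin n, |f p.1 - f (flipBit p.1 p.2)|

end LocalTail

end

namespace LocalTail

open Finset
open scoped BigOperators

variable {n : ℕ}

/-! Clip `f` to `[a, b]` and call the result `g`; let `q` be the mass of `(a, b + B)` and `p` that
of `[b, ∞)`. The two sides come from bounding the variance of `g`. Since `a` is at least the median,
`g` sits at its floor `a` with probability at least 1/2, which forces variance at least `p (b - a)²
/ 2` (`le_cubeVar_clip`). Conversely, the upper end of any edge on which `g` changes has its
`f`-value in `(a, b + B)`. So the total energy of the derivatives is at most `v q / 2`, and each
derivative lives on a set of mass at most `2q`. Small support gains a logarithm over Efron-Stein, as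
in Talagrand's inequality (`cubeVar_mul_log_le`): by hypercontractivity such a derivative has little
low-frequency mass, and high frequencies `S` enter the variance with weight `1 / #S`. -/

lemma flipBit_flipBit (x : Cube n) (i : Fin n) : flipBit (flipBit x i) i = x := by
  simp [flipBit]

lemma expect_flipBit (g : Cube n → ℝ) (i : Fin n) :
    𝔼 x, g (flipBit x i) = 𝔼 x, g x :=
  Fintype.expect_equiv (Function.Involutive.toPerm (fun x => flipBit x i)
    (fun x => flipBit_flipBit x i)) _ _ (fun _ => rfl)

lemma sq_expect_mul_le (g h : Cube n → ℝ) :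
    (𝔼 x, g x * h x) ^ 2 ≤ (𝔼 x, g x ^ 2) * 𝔼 x, h x ^ 2 :=
  Finset.expect_mul_sq_le_sq_mul_sq _ _ _

/-! ### Walsh functions -/

/-- The sign `(-1) ^ b` of a bit. -/
noncomputable def bitSign (b : Bool) : ℝ := if b then -1 else 1

lemma bitSign_mul_self (b : Bool) : bitSign b * bitSign b = 1 := by
  cases b <;> simp [bitSign]

lemma bitSign_not (b : Bool) : bitSign (!b) = -bitSign b := by
  cases b <;> simp [bitSign]

/-- The Walsh function indexed by `S`. -/
noncomputable def walsh (S : Finset (Fin n)) (x : Cube n) : ℝ := ∏ i ∈ S, bitSign (x i)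

lemma walsh_flipBit_of_notMem {S : Finset (Fin n)} {i : Fin n} (h : i ∉ S) (x : Cube n) :
    walsh S (flipBit x i) = walsh S x := by
  refine Finset.prod_congr rfl fun j hj => ?_
  have : j ≠ i := fun e => h (e ▸ hj)
  simp [flipBit, this]

lemma walsh_insert {S : Finset (Fin n)} {i : Fin n} (h : i ∉ S) (x : Cube n) :
    walsh (insert i S) x = bitSign (x i) * walsh S x := by
  simp [walsh, h]

lemma walsh_flipBit_of_mem {S : Finset (Fin n)} {i : Fin n} (h : i ∈ S) (x : Cube n) :
    walsh S (flipBit x i) = -walsh S x := by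
  rw [← Finset.insert_erase h, walsh_insert (Finset.notMem_erase i S),
    walsh_insert (Finset.notMem_erase i S), walsh_flipBit_of_notMem (Finset.notMem_erase i S)]
  simp [flipBit, bitSign_not]

/-- The sum over `S` factors over coordinates, and a coordinate where `x` and `y` differ contributes
a zero factor. -/
lemma sum_walsh_mul_walsh (x y : Cube n) :
    ∑ S : Finset (Fin n), walsh S x * walsh S y = if x = y then 2 ^ n else 0 := by
  have h : ∑ S : Finset (Fin n), walsh S x * walsh S y
      = ∏ i : Fin n, (1 + bitSign (x i) * bitSign (y i)) := by
    rw [Finset.prod_one_add, Finset.powerset_univ]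
    simp [walsh, Finset.prod_mul_distrib]
  rw [h]
  split_ifs with hxy
  · subst hxy
    simp [bitSign_mul_self]
    norm_num
  · obtain ⟨i, hi⟩ := Function.ne_iff.mp hxy
    refine Finset.prod_eq_zero (Finset.mem_univ i) ?_
    revert hi
    cases x i <;> cases y i <;> simp [bitSign]

/-- The Walsh-Fourier coefficient of `g` at `S`. -/
noncomputable def coeff (g : Cube n → ℝ) (S : Finset (Fin n)) : ℝ := 𝔼 x, g x * walsh S x

lemma sum_coeff_mul_walsh (g : Cube n → ℝ) (x : Cube n) :
    ∑ S, coeff g S * walsh S x = g x := by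
  simp only [coeff, Finset.expect_mul]
  rw [← Finset.expect_sum_comm]
  have h : ∀ y : Cube n, ∑ S, g y * walsh S y * walsh S x
      = g y * if y = x then 2 ^ n else 0 := fun y => by
    rw [← sum_walsh_mul_walsh, Finset.mul_sum]
    exact Finset.sum_congr rfl fun S _ => mul_assoc _ _ _
  simp only [h, Fintype.expect_eq_sum_div_card]
  simp

lemma expect_mul_sum_walsh (g : Cube n → ℝ) (c : Finset (Fin n) → ℝ) :
    𝔼 x, g x * ∑ S, c S * walsh S x = ∑ S, c S * coeff g S := by
  simp only [coeff, Finset.mul_expect, Finset.mul_sum]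
  rw [Finset.expect_sum_comm]
  refine Finset.sum_congr rfl fun S _ => Finset.expect_congr rfl fun x _ => by ring

lemma expect_sq_eq_sum_coeff_sq (g : Cube n → ℝ) : 𝔼 x, g x ^ 2 = ∑ S, coeff g S ^ 2 := by
  have h := expect_mul_sum_walsh g (coeff g)
  simp only [sum_coeff_mul_walsh] at h
  simpa only [pow_two] using h

lemma coeff_empty (g : Cube n → ℝ) : coeff g ∅ = 𝔼 x, g x := by
  simp [coeff, walsh]

/-- The discrete derivative in direction `i`. -/
noncomputable def halfDiff (i : Fin n) (g : Cube n → ℝ) (x : Cube n) : ℝ := (g x - g (flipBit x i)) / 2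

lemma coeff_halfDiff (i : Fin n) (g : Cube n → ℝ) (S : Finset (Fin n)) :
    coeff (halfDiff i g) S = if i ∈ S then coeff g S else 0 := by
  have h : 𝔼 x, g (flipBit x i) * walsh S x = 𝔼 x, g x * walsh S (flipBit x i) := by
    rw [← expect_flipBit _ i]
    simp [flipBit_flipBit]
  have h2 : coeff (halfDiff i g) S = (coeff g S - 𝔼 x, g x * walsh S (flipBit x i)) / 2 := by
    rw [← h, coeff, coeff, ← Finset.expect_sub_distrib, Finset.expect_div]
    exact Finset.expect_congr rfl fun x _ => by rw [halfDiff]; ring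
  rw [h2]
  split_ifs with hi
  · simp [walsh_flipBit_of_mem hi, coeff, Finset.expect_neg_distrib]
  · simp [walsh_flipBit_of_notMem hi, coeff]

/-! ### Hypercontractivity -/

/-- The Bonami lemma: the fourth moment of a Walsh polynomial is controlled by a weighted sum of
squares of its coefficients. -/
lemma expect_pow_four_le (U : Finset (Fin n)) (c : Finset (Fin n) → ℝ) :
    𝔼 x, (∑ S ∈ U.powerset, c S * walsh S x) ^ 4
      ≤ (∑ S ∈ U.powerset, 3 ^ #S * c S ^ 2) ^ 2 := by
  induction U using Finset.induction_on generalizing c with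
  | empty => simp [walsh, ← pow_mul]
  | insert i U hi ih =>
    have hiS : ∀ S ∈ U.powerset, i ∉ S := fun S hS h => hi (Finset.mem_powerset.mp hS h)
    set Q : Cube n → ℝ := fun x => ∑ S ∈ U.powerset, c S * walsh S x with hQ
    set R : Cube n → ℝ := fun x => ∑ S ∈ U.powerset, c (insert i S) * walsh S x with hR
    have hP : ∀ x, ∑ S ∈ (insert i U).powerset, c S * walsh S x
        = Q x + bitSign (x i) * R x := fun x => by
      rw [Finset.sum_powerset_insert hi, hQ, hR, Finset.mul_sum]
      congr 1
      exact Finset.sum_congr rfl fun S hS => by rw [walsh_insert (hiS S hS)]; ring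
    have hQi : ∀ x, Q (flipBit x i) = Q x := fun x =>
      Finset.sum_congr rfl fun S hS => by rw [walsh_flipBit_of_notMem (hiS S hS)]
    have hRi : ∀ x, R (flipBit x i) = R x := fun x =>
      Finset.sum_congr rfl fun S hS => by rw [walsh_flipBit_of_notMem (hiS S hS)]
    -- Flipping bit `i` reverses the sign of the `R` term only, so averaging the two forms cancels
    -- its odd powers.
    have hflip : 𝔼 x, (Q x + bitSign (x i) * R x) ^ 4
        = 𝔼 x, (Q x - bitSign (x i) * R x) ^ 4 := by
      rw [← expect_flipBit _ i]
      refine Finset.expect_congr rfl fun x _ => ?_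
      rw [hQi, hRi]
      simp [flipBit, bitSign_not, sub_eq_add_neg]
    have hexp : 𝔼 x, (Q x + bitSign (x i) * R x) ^ 4
        = (𝔼 x, Q x ^ 4) + 6 * (𝔼 x, Q x ^ 2 * R x ^ 2) + 𝔼 x, R x ^ 4 := by
      have h2 : (𝔼 x, (Q x + bitSign (x i) * R x) ^ 4)
          + (𝔼 x, (Q x - bitSign (x i) * R x) ^ 4)
          = 2 * ((𝔼 x, Q x ^ 4) + 6 * (𝔼 x, Q x ^ 2 * R x ^ 2) + 𝔼 x, R x ^ 4) := by
        simp only [← Finset.expect_add_distrib, Finset.mul_expect]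
        refine Finset.expect_congr rfl fun x _ => ?_
        linear_combination (12 * Q x ^ 2 * R x ^ 2
          + 2 * R x ^ 4 * (bitSign (x i) * bitSign (x i) + 1)) * bitSign_mul_self (x i)
      linarith
    set A := ∑ S ∈ U.powerset, 3 ^ #S * c S ^ 2 with hA
    set B := ∑ S ∈ U.powerset, 3 ^ #S * c (insert i S) ^ 2 with hB
    have hA0 : 0 ≤ A := Finset.sum_nonneg fun S _ => by positivity
    have hB0 : 0 ≤ B := Finset.sum_nonneg fun S _ => by positivity
    have hW : ∑ S ∈ (insert i U).powerset, 3 ^ #S * c S ^ 2 = A + 3 * B := by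
      rw [Finset.sum_powerset_insert hi, hA, hB, Finset.mul_sum]
      congr 1
      exact Finset.sum_congr rfl fun S hS => by
        rw [Finset.card_insert_of_notMem (hiS S hS)]; ring
    have hQ4 : 𝔼 x, Q x ^ 4 ≤ A ^ 2 := ih c
    have hR4 : 𝔼 x, R x ^ 4 ≤ B ^ 2 := ih fun S => c (insert i S)
    have hQR : 𝔼 x, Q x ^ 2 * R x ^ 2 ≤ A * B := by
      have hcs := sq_expect_mul_le (fun x => Q x ^ 2) (fun x => R x ^ 2)
      simp only [← pow_mul, Nat.reduceMul] at hcs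
      refine abs_le_of_sq_le_sq' ?_ (mul_nonneg hA0 hB0) |>.2
      calc _ ≤ _ := hcs
        _ ≤ A ^ 2 * B ^ 2 := mul_le_mul hQ4 hR4
            (Finset.expect_nonneg fun x _ => by positivity) (by positivity)
        _ = (A * B) ^ 2 := by ring
    simp only [hP]
    rw [hexp, hW]
    nlinarith [mul_nonneg hA0 hB0, mul_nonneg hB0 hB0]

/-- The low-frequency mass of a function is small when its support is small. -/
lemma sum_inv_three_pow_mul_coeff_sq_le (h : Cube n → ℝ) (r : ℝ)
    (hr : 𝔼 x, (if h x = 0 then 0 else 1 : ℝ) ≤ r) :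
    ∑ S, (1 / 3 : ℝ) ^ #S * coeff h S ^ 2 ≤ √r * 𝔼 x, h x ^ 2 := by
  set W := ∑ S, (1 / 3 : ℝ) ^ #S * coeff h S ^ 2 with hW
  set u : Cube n → ℝ := fun x => ∑ S, ((1 / 3 : ℝ) ^ #S * coeff h S) * walsh S x with hu
  set χ : Cube n → ℝ := fun x => if h x = 0 then 0 else 1 with hχ
  have hE : 0 ≤ 𝔼 x, h x ^ 2 := Finset.expect_nonneg fun x _ => by positivity
  have hχ0 : 0 ≤ 𝔼 x, χ x := Finset.expect_nonneg fun x _ => by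
    simp only [hχ]; split_ifs <;> norm_num
  have hr0 : 0 ≤ r := hχ0.trans hr
  have hW0 : 0 ≤ W := Finset.sum_nonneg fun S _ => by positivity
  -- Duality: `u` is `h` damped by `3⁻¹` per frequency, and `χ` may be inserted because it is 1
  -- wherever `h` is nonzero. Cauchy-Schwarz twice then brings in the support size and the fourth
  -- moment of `u`.
  have hhu : 𝔼 x, h x * (χ x * u x) = W := by
    have : ∀ x, h x * (χ x * u x) = h x * u x := fun x => by
      by_cases h0 : h x = 0 <;> simp [hχ, h0]
    simp only [this]
    rw [hu, expect_mul_sum_walsh]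
    exact Finset.sum_congr rfl fun S _ => by ring
  have hu4 : 𝔼 x, u x ^ 4 ≤ W ^ 2 := by
    have := expect_pow_four_le (Finset.univ : Finset (Fin n))
      (fun S => (1 / 3 : ℝ) ^ #S * coeff h S)
    rw [Finset.powerset_univ] at this
    refine this.trans (le_of_eq ?_)
    congr 1
    refine Finset.sum_congr rfl fun S _ => ?_
    have h3 : (3 : ℝ) ^ #S * (1 / 3) ^ #S = 1 := by rw [← mul_pow]; norm_num
    linear_combination ((1 / 3 : ℝ) ^ #S * coeff h S ^ 2) * h3
  have h1 : W ^ 2 ≤ (𝔼 x, h x ^ 2) * 𝔼 x, (χ x * u x) ^ 2 := by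
    rw [← hhu]; exact sq_expect_mul_le _ _
  have hχu : 𝔼 x, (χ x * u x) ^ 2 ≤ √r * W := by
    have hcs := sq_expect_mul_le χ (fun x => u x ^ 2)
    have e1 : ∀ x, χ x ^ 2 = χ x := fun x => by simp only [hχ]; split_ifs <;> norm_num
    have e2 : ∀ x, (χ x * u x) ^ 2 = χ x * u x ^ 2 := fun x => by rw [mul_pow, e1]
    simp only [e1, ← pow_mul, Nat.reduceMul] at hcs
    simp only [e2]
    refine abs_le_of_sq_le_sq' ?_ (by positivity) |>.2
    calc _ ≤ _ := hcs
      _ ≤ r * W ^ 2 := mul_le_mul hr hu4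
          (Finset.expect_nonneg fun x _ => by positivity) hr0
      _ = (√r * W) ^ 2 := by rw [mul_pow, Real.sq_sqrt hr0]
  rcases hW0.eq_or_lt with h0 | hpos
  · rw [← h0]; positivity
  · have : W * W ≤ (√r * 𝔼 x, h x ^ 2) * W := by
      nlinarith [mul_le_mul_of_nonneg_left hχu hE]
    exact le_of_mul_le_mul_right this hpos

/-! ### Variance bounds -/

/-- The variance of `g` under the uniform distribution. -/
noncomputable def cubeVar (g : Cube n → ℝ) : ℝ := (𝔼 x, g x ^ 2) - (𝔼 x, g x) ^ 2

/-- The coefficient at a nonempty `S` survives in exactly `#S` of the derivatives. The empty set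
drops out on the left as the squared mean and on the right because `0⁻¹ = 0`. -/
lemma cubeVar_eq_sum (g : Cube n → ℝ) :
    cubeVar g = ∑ i, ∑ S, (#S : ℝ)⁻¹ * coeff (halfDiff i g) S ^ 2 := by
  rw [cubeVar, expect_sq_eq_sum_coeff_sq, ← coeff_empty, Finset.sum_comm,
    ← Finset.add_sum_erase _ _ (Finset.mem_univ ∅), add_sub_cancel_left,
    ← Finset.add_sum_erase _ (fun S => ∑ i, (#S : ℝ)⁻¹ * coeff (halfDiff i g) S ^ 2)
      (Finset.mem_univ ∅)]
  simp only [Finset.card_empty, Nat.cast_zero, inv_zero, zero_mul, Finset.sum_const_zero, zero_add]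
  refine Finset.sum_congr rfl fun S hS => ?_
  have hS0 : (#S : ℝ) ≠ 0 := by
    simpa using (Finset.mem_erase.mp hS).1
  simp [coeff_halfDiff, ite_pow, Finset.sum_ite_mem, hS0]

/-- The Efron-Stein (Poincaré) inequality on the cube. -/
lemma cubeVar_le_sum (g : Cube n → ℝ) : cubeVar g ≤ ∑ i, 𝔼 x, halfDiff i g x ^ 2 := by
  rw [cubeVar_eq_sum]
  refine Finset.sum_le_sum fun i _ => ?_
  rw [expect_sq_eq_sum_coeff_sq]
  refine Finset.sum_le_sum fun S _ => ?_
  exact mul_le_of_le_one_left (by positivity) (Nat.cast_inv_le_one _)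

/-- A soft cut-off at frequency `m`: above it `m⁻¹` suffices, below it the exponential `3 ^ (m - s)`
dominates. -/
lemma inv_le_of_one_le {m : ℝ} (hm : 1 ≤ m) (s : ℕ) :
    (s : ℝ)⁻¹ ≤ m⁻¹ * (1 + (3 : ℝ) ^ m * (1 / 3) ^ s) := by
  have hm0 : 0 < m := by linarith
  rcases Nat.eq_zero_or_pos s with rfl | hs
  · simp; positivity
  have hs1 : (1 : ℝ) ≤ s := by exact_mod_cast hs
  have hs0 : (0 : ℝ) < s := by linarith
  rcases le_total m s with hms | hms
  · calc (s : ℝ)⁻¹ ≤ m⁻¹ := inv_anti₀ hm0 hms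
      _ ≤ _ := le_mul_of_one_le_right (by positivity) (by
        have : (0 : ℝ) < (3 : ℝ) ^ m * (1 / 3) ^ s := by positivity
        linarith)
  · have h3 : (3 : ℝ) ^ m * (1 / 3) ^ s = (3 : ℝ) ^ (m - s) := by
      rw [Real.rpow_sub (by norm_num), Real.rpow_natCast, one_div, inv_pow, div_eq_mul_inv]
    have hb : 1 + (m - s) ≤ (3 : ℝ) ^ (m - s) := by
      rw [Real.rpow_def_of_pos (by norm_num)]
      have hl : 1 ≤ Real.log 3 := by
        rw [Real.le_log_iff_exp_le (by norm_num)]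
        linarith [Real.exp_one_lt_d9]
      have := Real.add_one_le_exp (Real.log 3 * (m - s))
      nlinarith [mul_nonneg (sub_nonneg.mpr hl) (sub_nonneg.mpr hms)]
    rw [h3, inv_mul_eq_div, inv_eq_one_div, div_le_div_iff₀ hs0 hm0]
    nlinarith [mul_nonneg (sub_nonneg.mpr hs1) (sub_nonneg.mpr hms)]

/-- A form of Talagrand's variance inequality for functions whose discrete derivatives all have
small support. -/
lemma cubeVar_mul_log_le (g : Cube n → ℝ) {r : ℝ} (hr0 : 0 < r) (hr1 : r ≤ 1)
    (hr : ∀ i, 𝔼 x, (if halfDiff i g x = 0 then 0 else 1 : ℝ) ≤ r) :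
    cubeVar g * Real.log (Real.exp 2 / r) ≤ (72 / 5) * ∑ i, 𝔼 x, halfDiff i g x ^ 2 := by
  set E := ∑ i, 𝔼 x, halfDiff i g x ^ 2 with hE
  have hE0 : 0 ≤ E := Finset.sum_nonneg fun i _ => Finset.expect_nonneg fun x _ => by positivity
  have hlog : Real.log (Real.exp 2 / r) = 2 - Real.log r := by
    rw [Real.log_div (Real.exp_pos 2).ne' hr0.ne', Real.log_exp]
  have hlr : Real.log r ≤ 0 := Real.log_nonpos hr0.le hr1
  have hl3 : 1 < Real.log 3 := by
    rw [Real.lt_log_iff_exp_lt (by norm_num)]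
    linarith [Real.exp_one_lt_d9]
  have hl3' : Real.log 3 < 6 / 5 := by
    rw [Real.log_lt_iff_lt_exp (by norm_num)]
    have h1 : (2.7 : ℝ) ≤ Real.exp 1 := by linarith [Real.exp_one_gt_d9]
    have h2 : Real.exp (6 / 5) = Real.exp 1 * Real.exp (1 / 5) := by
      rw [← Real.exp_add]; norm_num
    nlinarith [Real.add_one_le_exp (1 / 5 : ℝ), Real.exp_pos 1]
  rw [hlog]
  rcases le_total (2 * Real.log 3) (-Real.log r) with hL | hL
  -- This `m` makes `3 ^ m * √r = 1`, so low and high frequencies contribute equally.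
  · set m := -Real.log r / (2 * Real.log 3) with hm
    have hm1 : 1 ≤ m := by rw [hm, le_div_iff₀ (by linarith)]; linarith
    have h3m : (3 : ℝ) ^ m * √r = 1 := by
      rw [Real.rpow_def_of_pos (by norm_num), Real.sqrt_eq_rpow, Real.rpow_def_of_pos hr0,
        ← Real.exp_add, Real.exp_eq_one_iff, hm]
      field_simp
      ring
    have hvar : cubeVar g ≤ 2 / m * E := by
      rw [cubeVar_eq_sum, hE, Finset.mul_sum]
      refine Finset.sum_le_sum fun i _ => ?_
      have hlow := sum_inv_three_pow_mul_coeff_sq_le (halfDiff i g) r (hr i)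
      calc ∑ S, (#S : ℝ)⁻¹ * coeff (halfDiff i g) S ^ 2
          ≤ ∑ S, m⁻¹ * (1 + (3 : ℝ) ^ m * (1 / 3) ^ #S) * coeff (halfDiff i g) S ^ 2 :=
            Finset.sum_le_sum fun S _ =>
              mul_le_mul_of_nonneg_right (inv_le_of_one_le hm1 _) (by positivity)
        _ = m⁻¹ * ((∑ S, coeff (halfDiff i g) S ^ 2)
              + (3 : ℝ) ^ m * ∑ S, (1 / 3 : ℝ) ^ #S * coeff (halfDiff i g) S ^ 2) := by
            rw [Finset.mul_sum, ← Finset.sum_add_distrib, Finset.mul_sum]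
            exact Finset.sum_congr rfl fun S _ => by ring
        _ ≤ m⁻¹ * ((𝔼 x, halfDiff i g x ^ 2)
              + (3 : ℝ) ^ m * (√r * 𝔼 x, halfDiff i g x ^ 2)) := by
            rw [← expect_sq_eq_sum_coeff_sq]
            gcongr
        _ = 2 / m * 𝔼 x, halfDiff i g x ^ 2 := by
            rw [← mul_assoc ((3 : ℝ) ^ m), h3m]; ring
    -- The left side is `4 / m + 4 * log 3`, below `44 / 5` since `m ≥ 1`.
    have hmL : 2 / m * (2 - Real.log r) ≤ 72 / 5 := by
      have hm0 : 0 < m := by linarith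
      have : -Real.log r = m * (2 * Real.log 3) := by rw [hm]; field_simp
      rw [div_mul_eq_mul_div, div_le_iff₀ hm0]
      nlinarith
    calc cubeVar g * (2 - Real.log r) ≤ 2 / m * E * (2 - Real.log r) :=
          mul_le_mul_of_nonneg_right hvar (by linarith)
      _ = 2 / m * (2 - Real.log r) * E := by ring
      _ ≤ _ := mul_le_mul_of_nonneg_right hmL hE0
  -- For larger `r` the logarithmic factor is bounded and Efron-Stein is enough.
  · calc cubeVar g * (2 - Real.log r) ≤ E * (2 - Real.log r) :=
          mul_le_mul_of_nonneg_right (cubeVar_le_sum g) (by linarith)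
      _ ≤ E * (72 / 5) := mul_le_mul_of_nonneg_left (by linarith) hE0
      _ = _ := mul_comm _ _

lemma cubeVar_eq_expect_sub_sq (g : Cube n → ℝ) (c : ℝ) :
    cubeVar g = (𝔼 x, (g x - c) ^ 2) - (𝔼 x, (g x - c)) ^ 2 := by
  have h1 : 𝔼 x, (g x - c) ^ 2 = (𝔼 x, g x ^ 2) - 2 * c * (𝔼 x, g x) + c ^ 2 := by
    have : (𝔼 _x : Cube n, c ^ 2) = c ^ 2 := Fintype.expect_const _
    rw [Finset.mul_expect]
    conv_rhs => rw [← this]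
    rw [← Finset.expect_sub_distrib, ← Finset.expect_add_distrib]
    exact Finset.expect_congr rfl fun x _ => by ring
  have h2 : 𝔼 x, (g x - c) = (𝔼 x, g x) - c := by
    rw [Finset.expect_sub_distrib, Fintype.expect_const]
  rw [cubeVar, h1, h2]
  ring

/-! ### Probabilities and the median -/

open scoped Classical in
lemma prob_eq_expect (f : Cube n → ℝ) (S : Set ℝ) :
    prob f S = 𝔼 x, (if f x ∈ S then 1 else 0 : ℝ) := by
  have h : {x | f x ∈ S} = ((Finset.univ.filter fun x => f x ∈ S : Finset (Cube n)) : Set _) := by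
    ext; simp
  rw [prob, unif, h, measureReal_def, ProbabilityTheory.uniformOn_univ, Measure.count_apply_finset,
    Fintype.expect_eq_sum_div_card]
  simp [ENNReal.toReal_div]

lemma prob_mono (f : Cube n → ℝ) {S T : Set ℝ} (h : S ⊆ T) : prob f S ≤ prob f T := by
  classical
  rw [prob_eq_expect, prob_eq_expect]
  refine Finset.expect_le_expect fun x _ => ?_
  by_cases hS : f x ∈ S
  · simp [hS, h hS]
  · simp only [hS, if_false]
    split_ifs <;> norm_num

lemma prob_Iic_add_prob_Ioi (f : Cube n → ℝ) (a : ℝ) :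
    prob f (Set.Iic a) + prob f (Set.Ioi a) = 1 := by
  classical
  rw [prob_eq_expect, prob_eq_expect, ← Finset.expect_add_distrib]
  rw [← Fintype.expect_const (ι := Cube n) (1 : ℝ)]
  refine Finset.expect_congr rfl fun x _ => ?_
  rcases le_or_gt (f x) a with h | h
  · simp [h, h.not_gt]
  · simp [h, h.not_ge]

lemma half_le_prob_Iic (f : Cube n → ℝ) {a : ℝ} (ha : median f ≤ a) :
    1 / 2 ≤ prob f (Set.Iic a) := by
  classical
  by_contra hlt
  push Not at hlt
  have hne : (Finset.univ.filter fun x => a < f x).Nonempty := by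
    by_contra h
    rw [Finset.not_nonempty_iff_eq_empty, Finset.filter_eq_empty_iff] at h
    have : prob f (Set.Iic a) = 1 := by
      rw [prob_eq_expect, ← Fintype.expect_const (ι := Cube n) (1 : ℝ)]
      refine Finset.expect_congr rfl fun x _ => ?_
      simp [not_lt.mp (h (Finset.mem_univ x))]
    linarith
  obtain ⟨y, hy, hmin⟩ := Finset.exists_min_image _ f hne
  rw [Finset.mem_filter] at hy
  -- `f y` is the least value above `a`, so no level below it has more mass under it than `a` does.
  have hmed : f y ≤ median f := by
    obtain ⟨w, -, hmax⟩ := Finset.exists_max_image (Finset.univ : Finset (Cube n)) f ⟨y, by simp⟩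
    refine le_csInf ⟨f w, ?_⟩ fun z hz => ?_
    · have : prob f (Set.Iic (f w)) = 1 := by
        rw [prob_eq_expect, ← Fintype.expect_const (ι := Cube n) (1 : ℝ)]
        refine Finset.expect_congr rfl fun x _ => ?_
        simp [hmax x (Finset.mem_univ x)]
      simp only [Set.mem_ofPred_eq, this]
      norm_num
    · by_contra hzy
      push Not at hzy
      have hz' : (1 / 2 : ℝ) ≤ prob f (Set.Iic z) := hz
      have : prob f (Set.Iic z) ≤ prob f (Set.Iic a) := by
        rw [prob_eq_expect, prob_eq_expect]
        refine Finset.expect_le_expect fun x _ => ?_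
        by_cases hx : f x ≤ z
        · have : f x ≤ a := by
            by_contra hxa
            have := hmin x (Finset.mem_filter.mpr ⟨Finset.mem_univ x, not_le.mp hxa⟩)
            linarith
          simp [hx, this]
        · simp only [Set.mem_Iic, hx, if_false]
          split_ifs <;> norm_num
      linarith
  linarith [hy.2]

/-! ### Truncation -/

/-- The truncation of `f` to `[a, b]`. -/
noncomputable def clip (f : Cube n → ℝ) (a b : ℝ) (x : Cube n) : ℝ := max a (min b (f x))

lemma clip_sub_le (f : Cube n → ℝ) (a b : ℝ) (x y : Cube n) :
    max (clip f a b x - clip f a b y) 0 ≤ max (f x - f y) 0 := by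
  rcases le_total (f x) (f y) with h | h
  · have : clip f a b x ≤ clip f a b y := max_le_max_left a (min_le_min_left b h)
    rw [max_eq_right (by linarith)]
    exact le_max_right _ _
  · refine max_le_max_right 0 ?_
    simp only [clip]
    rcases le_total b (f x) with h1 | h1 <;> rcases le_total b (f y) with h2 | h2 <;>
      simp only [h1, h2, min_eq_left, min_eq_right] <;>
      simp only [max_def] <;> split_ifs <;> linarith

lemma abs_sub_flipBit_le_maxChange (f : Cube n → ℝ) (x : Cube n) (i : Fin n) :
    |f x - f (flipBit x i)| ≤ maxChange f :=
  le_ciSup (f := fun p : Cube n × Fin n => |f p.1 - f (flipBit p.1 p.2)|)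
    (Set.finite_range _).bddAbove (x, i)

lemma mem_Ioo_of_clip_flipBit_lt (f : Cube n → ℝ) {a b : ℝ} {x : Cube n} {i : Fin n}
    (h : clip f a b (flipBit x i) < clip f a b x) : f x ∈ Set.Ioo a (b + maxChange f) := by
  have h1 : a < f x := by
    by_contra hx
    push Not at hx
    have : clip f a b x = a := max_eq_left ((min_le_right _ _).trans hx)
    rw [this] at h
    exact absurd h (not_lt.mpr (le_max_left _ _))
  have h2 : f (flipBit x i) < b := by
    by_contra hy
    push Not at hy
    have : clip f a b (flipBit x i) = max a b := by rw [clip, min_eq_left hy]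
    rw [this] at h
    exact absurd h (not_lt.mpr (max_le_max_left a (min_le_left _ _)))
  have := (abs_le.mp (abs_sub_flipBit_le_maxChange f x i)).2
  exact ⟨h1, by linarith⟩

/-- The positive parts at the two ends of an edge have equal mean squares, so a one-sided bound
controls the full energy. -/
lemma expect_halfDiff_sq (g : Cube n → ℝ) (i : Fin n) :
    𝔼 x, halfDiff i g x ^ 2 = (𝔼 x, (max (g x - g (flipBit x i)) 0) ^ 2) / 2 := by
  have h : 𝔼 x, (max (g (flipBit x i) - g x) 0) ^ 2
      = 𝔼 x, (max (g x - g (flipBit x i)) 0) ^ 2 := by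
    rw [← expect_flipBit _ i]
    simp [flipBit_flipBit]
  have h2 : 4 * (𝔼 x, halfDiff i g x ^ 2) = (𝔼 x, (max (g x - g (flipBit x i)) 0) ^ 2)
      + 𝔼 x, (max (g (flipBit x i) - g x) 0) ^ 2 := by
    rw [← Finset.expect_add_distrib, Finset.mul_expect]
    refine Finset.expect_congr rfl fun x _ => ?_
    rw [halfDiff]
    rcases le_total (g x) (g (flipBit x i)) with hx | hx
    · rw [max_eq_right (by linarith), max_eq_left (by linarith)]; ring
    · rw [max_eq_left (by linarith), max_eq_right (by linarith)]; ring
  linarith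

lemma sum_expect_halfDiff_clip_sq_le (f : Cube n → ℝ) (v : ℝ)
    (hf : ∀ x, ∑ i : Fin n, (max (f x - f (flipBit x i)) 0) ^ 2 ≤ v) (a b : ℝ) :
    ∑ i, 𝔼 x, halfDiff i (clip f a b) x ^ 2
      ≤ v * prob f (Set.Ioo a (b + maxChange f)) / 2 := by
  classical
  simp only [expect_halfDiff_sq]
  rw [← Finset.sum_div, ← Finset.expect_sum_comm, prob_eq_expect, Finset.mul_expect]
  refine div_le_div_of_nonneg_right (Finset.expect_le_expect fun x _ => ?_) (by norm_num)
  by_cases hx : f x ∈ Set.Ioo a (b + maxChange f)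
  · rw [if_pos hx, mul_one]
    exact (Finset.sum_le_sum fun i _ =>
      pow_le_pow_left₀ (le_max_right _ _) (clip_sub_le f a b _ _) 2).trans (hf x)
  · rw [if_neg hx, mul_zero]
    refine (Finset.sum_eq_zero fun i _ => ?_).le
    have : ¬ clip f a b (flipBit x i) < clip f a b x := fun h =>
      hx (mem_Ioo_of_clip_flipBit_lt f h)
    rw [max_eq_right (by linarith)]
    norm_num

/-- The factor 2 is a union bound: the upper end of the edge may be `x` or its neighbour. -/
lemma expect_halfDiff_clip_ne_zero_le (f : Cube n → ℝ) (a b : ℝ) (i : Fin n) :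
    𝔼 x, (if halfDiff i (clip f a b) x = 0 then 0 else 1 : ℝ)
      ≤ 2 * prob f (Set.Ioo a (b + maxChange f)) := by
  classical
  rw [prob_eq_expect, two_mul]
  nth_rewrite 3 [← expect_flipBit _ i]
  rw [← Finset.expect_add_distrib]
  refine Finset.expect_le_expect fun x _ => ?_
  rcases lt_trichotomy (clip f a b x) (clip f a b (flipBit x i)) with h | h | h
  · have : f (flipBit x i) ∈ Set.Ioo a (b + maxChange f) :=
      mem_Ioo_of_clip_flipBit_lt (i := i) f (by rwa [flipBit_flipBit])
    rw [if_pos this]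
    split_ifs <;> norm_num
  · have : halfDiff i (clip f a b) x = 0 := by rw [halfDiff, h]; ring
    rw [if_pos this]
    split_ifs <;> norm_num
  · have := mem_Ioo_of_clip_flipBit_lt f h
    rw [if_pos this]
    split_ifs <;> norm_num

lemma le_cubeVar_clip (f : Cube n → ℝ) {a b : ℝ} (hab : a < b) (ha : median f ≤ a) :
    prob f (Set.Ici b) * (b - a) ^ 2 / 2 ≤ cubeVar (clip f a b) := by
  classical
  have hA : prob f (Set.Ioi a) ≤ 1 / 2 := by
    linarith [half_le_prob_Iic f ha, prob_Iic_add_prob_Ioi f a]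
  set h : Cube n → ℝ := fun x => clip f a b x - a with hh
  -- As `h` vanishes off `{f > a}`, of mass at most 1/2, the squared mean is at most half the second
  -- moment.
  have hcs : (𝔼 x, h x) ^ 2 ≤ (𝔼 x, h x ^ 2) * prob f (Set.Ioi a) := by
    have := sq_expect_mul_le h (fun x => if f x ∈ Set.Ioi a then 1 else 0)
    have e1 : ∀ x, h x * (if f x ∈ Set.Ioi a then 1 else 0 : ℝ) = h x := fun x => by
      by_cases hx : f x ∈ Set.Ioi a
      · simp [hx]
      · have : h x = 0 := by
          rw [hh]
          exact sub_eq_zero.mpr (max_eq_left ((min_le_right _ _).trans (not_lt.mp hx)))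
        rw [this, zero_mul]
    simp only [e1, ite_pow, one_pow, ne_eq, OfNat.ofNat_ne_zero, not_false_eq_true,
      zero_pow] at this
    rw [prob_eq_expect]
    convert this
  have hE0 : 0 ≤ 𝔼 x, h x ^ 2 := Finset.expect_nonneg fun x _ => by positivity
  have hlow : prob f (Set.Ici b) * (b - a) ^ 2 ≤ 𝔼 x, h x ^ 2 := by
    rw [prob_eq_expect, Finset.expect_mul]
    refine Finset.expect_le_expect fun x _ => ?_
    by_cases hx : f x ∈ Set.Ici b
    · have : clip f a b x = b := by
        rw [clip, min_eq_left hx, max_eq_right hab.le]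
      simp [hh, hx, this]
    · rw [if_neg hx, zero_mul]; positivity
  rw [cubeVar_eq_expect_sub_sq _ a]
  nlinarith

end LocalTail

theorem theorem2p1 (n : ℕ) (f : LocalTail.Cube n → ℝ) (v : ℝ) (hv : 0 < v)
    (hf : ∀ x : LocalTail.Cube n,
      ∑ i : Fin n, (max (f x - f (LocalTail.flipBit x i)) 0) ^ 2 ≤ v)
    (B : ℝ) (hB : B = LocalTail.maxChange f)
    (a b : ℝ) (ha : LocalTail.median f ≤ a) (hab : a < b)
    (hb : 0 < LocalTail.prob f (Set.Ici b)) :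
    b - a ≤ Real.sqrt (((72 / 5) * v * LocalTail.prob f (Set.Ioo a (b + B))) /
        (LocalTail.prob f (Set.Ici b) *
          Real.log (Real.exp 2 / (2 * LocalTail.prob f (Set.Ioo a (b + B)))))) ∧
    Real.sqrt (((72 / 5) * v * LocalTail.prob f (Set.Ioo a (b + B))) /
        (LocalTail.prob f (Set.Ici b) *
          Real.log (Real.exp 2 / (2 * LocalTail.prob f (Set.Ioo a (b + B)))))) ≤
      Real.sqrt (((72 / 5) * v * LocalTail.prob f (Set.Ioi a)) /
        (LocalTail.prob f (Set.Ici b) *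
          Real.log (Real.exp 2 / (2 * LocalTail.prob f (Set.Ioi a))))) := by
  subst hB
  set p := LocalTail.prob f (Set.Ici b) with hp
  set q := LocalTail.prob f (Set.Ioo a (b + LocalTail.maxChange f)) with hq
  set t := LocalTail.prob f (Set.Ioi a) with ht
  have ht2 : t ≤ 1 / 2 := by
    linarith [LocalTail.half_le_prob_Iic f ha, LocalTail.prob_Iic_add_prob_Ioi f a]
  have hqt : q ≤ t := LocalTail.prob_mono f fun _ hy => hy.1
  have hlow := LocalTail.le_cubeVar_clip f hab ha
  have hup := LocalTail.sum_expect_halfDiff_clip_sq_le f v hf a b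
  -- If `q` were 0 the energy would vanish, yet the variance is positive.
  have hq0 : 0 < q := by
    have hpos : 0 < p * (b - a) ^ 2 / 2 := by
      have := sub_pos.mpr hab
      positivity
    have : 0 < v * q := by
      linarith [LocalTail.cubeVar_le_sum (LocalTail.clip f a b)]
    exact pos_of_mul_pos_right this hv.le
  have hlog : ∀ s : ℝ, 0 < s → s ≤ 1 / 2 → 0 < Real.log (Real.exp 2 / (2 * s)) := by
    intro s hs hs2
    refine Real.log_pos ?_
    rw [one_lt_div (by linarith)]
    linarith [Real.add_one_le_exp (2 : ℝ)]
  have hlq := hlog q hq0 (hqt.trans ht2)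
  have hlt := hlog t (hq0.trans_le hqt) ht2
  constructor
  · refine Real.le_sqrt_of_sq_le ?_
    have htal := LocalTail.cubeVar_mul_log_le (LocalTail.clip f a b) (r := 2 * q)
      (by linarith) (by linarith) (LocalTail.expect_halfDiff_clip_ne_zero_le f a b)
    rw [le_div_iff₀ (mul_pos hb hlq)]
    nlinarith [mul_le_mul_of_nonneg_right hlow hlq.le]
  -- Passing from `q` to `t ≥ q` raises the numerator and lowers the logarithm, which stays positive
  -- as `t ≤ 1/2`.
  · have : 0 < t := hq0.trans_le hqt
    refine Real.sqrt_le_sqrt ?_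
    gcongr
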